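/- Let $\mathcal H_S$ be a two-dimensional complex Hilbert space (the system) and $\mathcal H_A$ a complex Hilbert space (the apparatus). Let $Q$ be an orthogonal projection on $\mathcal H_S$ and let $|q_0\rangle,|q_1\rangle\in\mathcal H_S$ be unit vectors with $Q|q_0\rangle=0$ and $Q|q_1\rangle=|q_1\rangle$. Let $H_S$ be a self-adjoint operator on $\mathcal H_S$, and let $H_A$ on $\mathcal H_A$ and $V$ on $\mathcal H_S\otimes\mathcal H_A$ be self-adjoint operators, possibly unbounded, such that $H_S\otimes\mathbf 1_A+\mathbf 1_S\otimes H_A+V$, defined on the intersection of the domains, is essentially self-adjoint. Let $H$ be its closure, let $\hbar>0$ and put $U(t)=\exp(-iHt/\hbar)$. Let $|\Omega\rangle\in\mathcal H_A$ be a unit vector, let $\tau\ge 0$, and for $j=0,1$ let $$\rho^A_j(\tau)=\mathrm{tr}_{\mathcal H_S}\bigl(U(\tau)\,(|q_j\rangle\langle q_j|\otimes|\Omega\rangle\langle\Omega|)\,U(\tau)^*\bigr)$$ be the corresponding final states of the apparatus. For states $\rho,\sigma$ let $F(\rho,\sigma)=\mathrm{tr}\sqrt{\sigma^{1/2}\rho\,\sigma^{1/2}}$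 be their fidelity, let $[X,Y]=XY-YX$, and let $\Vert\cdot\Vert$ be the operator norm; the norm of $[V,H_S\otimes\mathbf 1_A]$ is the supremum of $\Vert[V,H_S\otimes\mathbf 1_A]\psi\Vert/\Vert\psi\Vert$ over the nonzero $\psi$ in the domain $D(V)$ of $V$, and is $\infty$ if $H_S\otimes\mathbf 1_A$ does not map $D(V)$ into itself. If the measurement is error-free, that is, if $F(\rho^A_0(\tau),\rho^A_1(\tau))=0$, then $$\tau\cdot\Vert[V,H_S\otimes\mathbf 1_A]\Vert\;\ge\;\hbar\,\Vert[Q,H_S]\Vert .$$ In particular, if moreover $Q$ does not commute with $H_S$, then $V$ does not commute with $H_S\otimes\mathbf 1_A$ (where $V$ commutes with the bounded operator $B=H_S\otimes\mathbf 1_A$ if $B\,D(V)\subseteq D(V)$ and $VB\psi=BV\psi$ for all $\psi\in D(V)$). -/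

import Mathlib

open scoped TensorProduct ENNReal InnerProductSpace

noncomputable section

namespace QMeas

variable {E S A : Type*}
  [NormedAddCommGroup E] [InnerProductSpace ℂ E]
  [NormedAddCommGroup S] [InnerProductSpace ℂ S]
  [NormedAddCommGroup A] [InnerProductSpace ℂ A]

/-- As `S` is finite dimensional, the algebraic tensor product `S ⊗ A` is complete, so it is
the Hilbert space tensor product. -/
instance instCompleteSpaceTensor [FiniteDimensional ℂ S] [CompleteSpace A] :
    CompleteSpace (S ⊗[ℂ] A) := by
  classical
  let b := stdOrthonormalBasis ℂ S
  let coord : Fin (Module.finrank ℂ S) → (S ⊗[ℂ] A) →L[ℂ] A := fun i =>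
    (TensorProduct.lidIsometry ℂ A).toLinearIsometry.toContinuousLinearMap ∘L
      (innerSL ℂ (b i)).rTensor A
  have hsum : ∀ x : S ⊗[ℂ] A, ∑ i, b i ⊗ₜ[ℂ] coord i x = x := by
    intro x
    induction x with
    | zero => simp
    | tmul s a =>
      have : ∀ i, coord i (s ⊗ₜ a) = ⟪b i, s⟫_ℂ • a := by
        intro i; simp [coord]
      simp_rw [this, ← TensorProduct.smul_tmul, ← TensorProduct.sum_tmul]
      rw [b.sum_repr']
    | add x y hx hy =>
      simp only [map_add, TensorProduct.tmul_add, Finset.sum_add_distrib, hx, hy]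
  refine Metric.complete_of_cauchySeq_tendsto fun u hu => ?_
  have hc : ∀ i, ∃ a : A, Filter.Tendsto (fun n => coord i (u n)) Filter.atTop (nhds a) := fun i =>
    cauchySeq_tendsto_of_complete (hu.map (coord i).uniformContinuous)
  choose a ha using hc
  refine ⟨∑ i, b i ⊗ₜ[ℂ] a i, ?_⟩
  have h : Filter.Tendsto (fun n => ∑ i, b i ⊗ₜ[ℂ] coord i (u n)) Filter.atTop
      (nhds (∑ i, b i ⊗ₜ[ℂ] a i)) :=
    tendsto_finsetSum _ fun i _ =>
      ((TensorProduct.mkL ℂ S A (b i)).continuous.tendsto (a i)).comp (ha i)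
  simpa only [hsum] using h

/-! ### Trace, partial trace and fidelity -/

/-- The trace `∑ᵢ ⟨eᵢ, T eᵢ⟩ ∈ [0, ∞]` of a positive bounded operator, for a Hilbert basis
`(eᵢ)` (the value does not depend on the basis). -/
def posTrace [CompleteSpace A] (T : A →L[ℂ] A) : ℝ≥0∞ :=
  ∑' i : (exists_hilbertBasis ℂ A).choose, ENNReal.ofReal (RCLike.re ⟪(i : A), T i⟫_ℂ)

/-- The fidelity `F(ρ, σ) = tr √(σ^{1/2} ρ σ^{1/2})` of two states (positive operators). -/
def fidelity [CompleteSpace A] (ρ σ : A →L[ℂ] A) : ℝ≥0∞ :=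
  posTrace (CFC.sqrt (CFC.sqrt σ * ρ * CFC.sqrt σ))

/-- The partial trace over the finite-dimensional factor `S`:
`tr_S T = ∑ᵢ (⟨eᵢ| ⊗ 1) T (|eᵢ⟩ ⊗ 1)` for an orthonormal basis `(eᵢ)` of `S`. -/
def partialTrace [FiniteDimensional ℂ S] [CompleteSpace A]
    (T : (S ⊗[ℂ] A) →L[ℂ] (S ⊗[ℂ] A)) : A →L[ℂ] A :=
  ∑ i, (TensorProduct.mkL ℂ S A (stdOrthonormalBasis ℂ S i)).adjoint ∘L T ∘L
    TensorProduct.mkL ℂ S A (stdOrthonormalBasis ℂ S i)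

/-- The final state `tr_S (W (|q⟩⟨q| ⊗ |Ω⟩⟨Ω|) W*)` of the apparatus, when the composite system
evolves by the unitary operator `W` from the initial product state `|q⟩⟨q| ⊗ |Ω⟩⟨Ω|`. -/
def apparatusState [FiniteDimensional ℂ S] [CompleteSpace A]
    (W : (S ⊗[ℂ] A) →L[ℂ] (S ⊗[ℂ] A)) (q : S) (Ω : A) : A →L[ℂ] A :=
  partialTrace (W * TensorProduct.mapL (InnerProductSpace.rankOne ℂ q q)
    (InnerProductSpace.rankOne ℂ Ω Ω) * star W)

/-! ### Hamiltonians (possibly unbounded) and time evolution -/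

/-- The inclusion `S ⊗ D(T) → S ⊗ A` is injective. -/
theorem lTensor_subtype_injective (D : Submodule ℂ A) :
    Function.Injective (D.subtype.lTensor S) :=
  Module.Flat.lTensor_preserves_injective_linearMap _ D.subtype_injective

variable (S) in
/-- The operator `1 ⊗ T` for a possibly unbounded operator `T` on `A`. Its domain is `S ⊗ D(T)`
(an algebraic tensor product; `S` will be finite dimensional). -/
def oneTensor (T : A →ₗ.[ℂ] A) : (S ⊗[ℂ] A) →ₗ.[ℂ] (S ⊗[ℂ] A) where
  domain := LinearMap.range (T.domain.subtype.lTensor S)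
  toFun := T.toFun.lTensor S ∘ₗ
    (LinearEquiv.ofInjective _ (lTensor_subtype_injective T.domain)).symm.toLinearMap

theorem oneTensor_apply (T : A →ₗ.[ℂ] A) (x : S ⊗[ℂ] T.domain)
    (h : T.domain.subtype.lTensor S x ∈ (oneTensor S T).domain) :
    oneTensor S T ⟨T.domain.subtype.lTensor S x, h⟩ = T.toFun.lTensor S x :=
  congrArg (T.toFun.lTensor S)
    ((LinearEquiv.ofInjective _ (lTensor_subtype_injective T.domain)).symm_apply_apply x)

/-- An everywhere defined bounded operator, seen as an operator with a domain. -/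
abbrev ofBounded (B : E →L[ℂ] E) : E →ₗ.[ℂ] E := (B : E →ₗ[ℂ] E).toPMap ⊤

/-- The total Hamiltonian `H = H_S ⊗ 1 + 1 ⊗ H_A + V`: the closure of the operator sum, which is
defined on the intersection of the domains. -/
def totalHamiltonian (HS : S →L[ℂ] S) (HA : A →ₗ.[ℂ] A)
    (V : (S ⊗[ℂ] A) →ₗ.[ℂ] (S ⊗[ℂ] A)) : (S ⊗[ℂ] A) →ₗ.[ℂ] (S ⊗[ℂ] A) :=
  (ofBounded (HS.rTensor A) + oneTensor S HA + V).closure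

/-- `U(t) = exp(-i H t / ħ)` for a self-adjoint, possibly unbounded `H`: `U` is the strongly
continuous one-parameter group of unitary operators whose infinitesimal generator is exactly
`-(i/ħ) H`. By Stone's theorem there is exactly one such `U`. -/
structure IsTimeEvolution [CompleteSpace E] (ħ : ℝ) (H : E →ₗ.[ℂ] E) (U : ℝ → E →L[ℂ] E) :
    Prop where
  mem_unitary : ∀ t, U t ∈ unitary (E →L[ℂ] E)
  map_zero : U 0 = 1
  map_add : ∀ s t, U (s + t) = U s * U t
  continuous : ∀ ψ, Continuous fun t => U t ψ
  generator : ∀ ψ χ : E, HasDerivAt (fun t => U t ψ) χ 0 ↔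
    ∃ h : ψ ∈ H.domain, χ = (-(Complex.I / (ħ : ℂ))) • H ⟨ψ, h⟩

/-- For a bounded self-adjoint `H`, the time evolution is the operator exponential. -/
theorem isTimeEvolution_exp [CompleteSpace E] (ħ : ℝ) (B : E →L[ℂ] E) (hB : IsSelfAdjoint B) :
    IsTimeEvolution ħ (ofBounded B)
      (fun t => NormedSpace.exp (t • ((-(Complex.I / (ħ : ℂ))) • B))) := by
  let _ : NormedAlgebra ℚ (E →L[ℂ] E) := NormedAlgebra.restrictScalars ℚ ℂ (E →L[ℂ] E)
  set G : E →L[ℂ] E := (-(Complex.I / (ħ : ℂ))) • B with hG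
  have hskew : star G = -G := by
    rw [hG, star_smul, hB.star_eq, ← neg_smul]
    congr 1
    simp [neg_div]
  have hderiv : ∀ t : ℝ, HasDerivAt (fun t : ℝ => NormedSpace.exp (t • G))
      (NormedSpace.exp (t • G) * G) t := fun t => hasDerivAt_exp_smul_const (𝕂 := ℝ) G t
  have hadd : ∀ s t : ℝ, NormedSpace.exp ((s + t) • G) =
      NormedSpace.exp (s • G) * NormedSpace.exp (t • G) := by
    intro s t
    rw [add_smul]
    exact NormedSpace.exp_add_of_commute
      (((Commute.refl G).smul_left _).smul_right _)
  have hstar : ∀ t : ℝ, star (NormedSpace.exp (t • G)) = NormedSpace.exp ((-t) • G) := by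
    intro t
    rw [NormedSpace.star_exp, star_smul, hskew]
    simp
  refine ⟨fun t => ?_, by simp, hadd, fun ψ => ?_, fun ψ χ => ?_⟩
  · rw [Unitary.mem_iff, hstar, ← hadd, ← hadd]
    simp
  · exact (continuous_iff_continuousAt.2 fun t => (hderiv t).continuousAt).clm_apply
      continuous_const
  · have h0 : HasDerivAt (fun t : ℝ => NormedSpace.exp (t • G) ψ) (G ψ) 0 := by
      let ev : (E →L[ℂ] E) →L[ℝ] E :=
        (ContinuousLinearMap.apply ℂ E ψ).restrictScalars ℝ
      have h := ev.hasFDerivAt.comp_hasDerivAt (0 : ℝ) (hderiv 0)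
      have e : ev (NormedSpace.exp ((0 : ℝ) • G) * G) = G ψ := by
        simp [ev]
      rw [e] at h
      exact h
    constructor
    · intro h
      exact ⟨trivial, h.unique h0⟩
    · rintro ⟨_, rfl⟩
      exact h0

/-! ### Commutators of a possibly unbounded operator with a bounded one -/

/-- The operator norm `sup_{ψ ∈ D(V), ψ ≠ 0} ‖[V, B] ψ‖ / ‖ψ‖ ∈ [0, ∞]` of the commutator
`[V, B] = V B - B V`, where it is `∞` if `B` does not map `D(V)` into itself. For self-adjoint
`V` and `B` this is the norm of the commutator form `⟨V φ, B ψ⟩ - ⟨B φ, V ψ⟩` on `D(V)`: if that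
form is bounded, then `B ψ ∈ D(V*) = D(V)` for every `ψ ∈ D(V)`. -/
def commutatorNorm (V : E →ₗ.[ℂ] E) (B : E →L[ℂ] E) : ℝ≥0∞ :=
  open Classical in
  ⨆ ψ : V.domain, if h : B ψ ∈ V.domain then ‖V ⟨B ψ, h⟩ - B (V ψ)‖ₑ / ‖(ψ : E)‖ₑ else ∞

/-- For bounded `V` this is the usual operator norm of `V B - B V`. -/
theorem commutatorNorm_ofBounded (V B : E →L[ℂ] E) :
    commutatorNorm (ofBounded V) B = ‖V * B - B * V‖ₑ := by
  have hval : commutatorNorm (ofBounded V) B =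
      ⨆ ψ : (ofBounded V).domain, ‖(V * B - B * V) (ψ : E)‖ₑ / ‖(ψ : E)‖ₑ := by
    unfold commutatorNorm
    refine iSup_congr fun ψ => ?_
    rw [dif_pos (show B ψ ∈ (ofBounded V).domain from trivial)]
    rfl
  rw [hval]
  apply le_antisymm
  · exact iSup_le fun ψ => ENNReal.div_le_of_le_mul ((V * B - B * V).le_opENorm _)
  · have hsup := le_iSup (fun ψ : (ofBounded V).domain =>
      ‖(V * B - B * V) (ψ : E)‖ₑ / ‖(ψ : E)‖ₑ)
    generalize (⨆ ψ : (ofBounded V).domain,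
      ‖(V * B - B * V) (ψ : E)‖ₑ / ‖(ψ : E)‖ₑ) = N at hsup ⊢
    rcases eq_or_ne N ∞ with rfl | hfin
    · exact le_top
    have hle : ∀ ψ : E, ‖(V * B - B * V) ψ‖ₑ ≤ N * ‖ψ‖ₑ := by
      intro ψ
      rcases eq_or_ne ψ 0 with rfl | hψ
      · simp
      have h := hsup ⟨ψ, trivial⟩
      rwa [ENNReal.div_le_iff (by simpa using hψ) (by simp)] at h
    lift N to NNReal using hfin
    rw [enorm_eq_nnnorm, ENNReal.coe_le_coe]
    refine ContinuousLinearMap.opNNNorm_le_bound _ _ fun ψ => ?_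
    have := hle ψ
    rw [enorm_eq_nnnorm, enorm_eq_nnnorm] at this
    exact_mod_cast this

/-- The possibly unbounded operator `V` commutes with the bounded operator `B`: `B V ⊆ V B`, that
is, `B` maps `D(V)` into itself and `V B ψ = B V ψ` for every `ψ ∈ D(V)`. -/
def CommutesWith (V : E →ₗ.[ℂ] E) (B : E →L[ℂ] E) : Prop :=
  ∀ ψ : V.domain, ∃ h : B ψ ∈ V.domain, V ⟨B ψ, h⟩ = B (V ψ)

end QMeas

end

/-! Follow the matrix element `m(t) = ⟪U t (q₀ ⊗ Ω), (HS ⊗ 1) U t (q₁ ⊗ Ω)⟫`. At `t = 0` it equals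
`⟪q₀, HS q₁⟫`, whose modulus bounds `‖[Q, HS]‖` because the system is a qubit
(`norm_projection_commutator_le`). At `t = τ` it is zero: zero fidelity makes the supports of the
apparatus states orthogonal, and an operator acting on the system alone cannot undo this
(`inner_rTensor_eq_zero_of_fidelity_eq_zero`). In between, `ħ |m'(t)|` is at most the norm of `[H,
HS ⊗ 1]`, where only `V` contributes, since `HS ⊗ 1` and `1 ⊗ HA` commute with `HS ⊗ 1`. As `H` is
unbounded, this bound is used as one on a sesquilinear form, carried from the operator sum to its
closure (`norm_commutator_form_le`) and then integrated over time
(`IsTimeEvolution.norm_inner_sub_inner_le`). -/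

namespace QMeas

/-! ### Zero fidelity means orthogonal supports. -/

section Fidelity

variable {A : Type*} [NormedAddCommGroup A] [InnerProductSpace ℂ A]

theorem inner_eq_zero_of_sum_rankOne_apply_eq_zero {ι : Type*} [Fintype ι] {a : ι → A} {x : A}
    (h : (∑ i, InnerProductSpace.rankOne ℂ (a i) (a i)) x = 0) (i : ι) : ⟪a i, x⟫_ℂ = 0 := by
  have h1 : ∑ j, ‖⟪a j, x⟫_ℂ‖ ^ 2 = 0 := by
    have h2 : ⟪x, (∑ i, InnerProductSpace.rankOne ℂ (a i) (a i)) x⟫_ℂ = 0 := by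
      rw [h, inner_zero_right]
    rw [sum_apply, inner_sum] at h2
    simp only [InnerProductSpace.rankOne_apply, inner_smul_right] at h2
    have h3 : ∀ j, ⟪a j, x⟫_ℂ * ⟪x, a j⟫_ℂ = ((‖⟪a j, x⟫_ℂ‖ ^ 2 : ℝ) : ℂ) := by
      intro j
      rw [← inner_conj_symm x (a j), RCLike.mul_conj]
      push_cast
      rfl
    simp only [h3] at h2
    exact_mod_cast h2
  have h4 := (Finset.sum_eq_zero_iff_of_nonneg (fun j _ => by positivity)).1 h1 i
    (Finset.mem_univ i)
  simpa using h4

variable [CompleteSpace A]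

/-- The diagonal entries are `‖√T eᵢ‖²`, so `√T` kills a Hilbert basis. -/
theorem eq_zero_of_posTrace_eq_zero {T : A →L[ℂ] A} (hT : 0 ≤ T) (h : posTrace T = 0) :
    T = 0 := by
  obtain ⟨b, hb⟩ := (exists_hilbertBasis ℂ A).choose_spec
  have hpos : T.IsPositive := ContinuousLinearMap.nonneg_iff_isPositive T |>.1 hT
  have hsq : CFC.sqrt T * CFC.sqrt T = T := CFC.sqrt_mul_sqrt_self T hT
  have hsa : star (CFC.sqrt T) = CFC.sqrt T := (CFC.sqrt_nonneg T).isSelfAdjoint.star_eq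
  have key : ∀ i : (exists_hilbertBasis ℂ A).choose, CFC.sqrt T (i : A) = 0 := by
    intro i
    have h1 := ENNReal.tsum_eq_zero.1 h i
    rw [ENNReal.ofReal_eq_zero] at h1
    have h2 : ⟪(i : A), T i⟫_ℂ = ⟪CFC.sqrt T (i : A), CFC.sqrt T (i : A)⟫_ℂ := by
      rw [← ContinuousLinearMap.adjoint_inner_right, ← ContinuousLinearMap.star_eq_adjoint, hsa,
        ← mul_apply_eq_comp, hsq]
    rw [h2] at h1
    rw [inner_self_eq_norm_sq] at h1
    exact norm_eq_zero.1 (pow_eq_zero_iff two_ne_zero |>.1 (h1.antisymm (sq_nonneg _)))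
  have hz : CFC.sqrt T = 0 := by
    refine ContinuousLinearMap.ext_on (s := Set.range b) ?_ ?_
    · have := b.dense_span
      rw [← Submodule.dense_iff_topologicalClosure_eq_top] at this
      exact this
    · rintro _ ⟨i, rfl⟩
      rw [hb]
      exact key i
  rw [← hsq, hz, mul_zero]

/-- `√σ ρ √σ = (√ρ √σ)* (√ρ √σ)`, so the C*-identity gives `√ρ √σ = 0`. -/
theorem mul_eq_zero_of_fidelity_eq_zero {ρ σ : A →L[ℂ] A} (hρ : 0 ≤ ρ) (hσ : 0 ≤ σ)
    (h : fidelity ρ σ = 0) : ρ * σ = 0 := by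
  have hσs : star (CFC.sqrt σ) = CFC.sqrt σ := (CFC.sqrt_nonneg σ).isSelfAdjoint.star_eq
  have hρs : star (CFC.sqrt ρ) = CFC.sqrt ρ := (CFC.sqrt_nonneg ρ).isSelfAdjoint.star_eq
  have hnn : 0 ≤ CFC.sqrt σ * ρ * CFC.sqrt σ := by
    have := star_left_conjugate_nonneg hρ (CFC.sqrt σ)
    rwa [hσs] at this
  have h0 : CFC.sqrt σ * ρ * CFC.sqrt σ = 0 :=
    (CFC.sqrt_eq_zero_iff _ hnn).1 (eq_zero_of_posTrace_eq_zero (CFC.sqrt_nonneg _) h)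
  have h1 : CFC.sqrt ρ * CFC.sqrt σ = 0 := by
    rw [← CStarRing.star_mul_self_eq_zero_iff, star_mul, hσs, hρs, ← h0]
    conv_rhs => rw [← CFC.sqrt_mul_sqrt_self ρ hρ]
    simp only [mul_assoc]
  calc ρ * σ = CFC.sqrt ρ * (CFC.sqrt ρ * CFC.sqrt σ) * CFC.sqrt σ := by
        conv_lhs => rw [← CFC.sqrt_mul_sqrt_self ρ hρ, ← CFC.sqrt_mul_sqrt_self σ hσ]
        simp only [mul_assoc]
    _ = 0 := by rw [h1]; simp

variable {ι κ : Type*} [Fintype ι] [Fintype κ]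

theorem inner_eq_zero_of_fidelity_sum_rankOne {a : ι → A} {c : κ → A}
    (h : fidelity (∑ i, InnerProductSpace.rankOne ℂ (a i) (a i))
      (∑ k, InnerProductSpace.rankOne ℂ (c k) (c k)) = 0) (i : ι) (k : κ) :
    ⟪a i, c k⟫_ℂ = 0 := by
  set ρ := ∑ i, InnerProductSpace.rankOne ℂ (a i) (a i) with hρdef
  set σ := ∑ k, InnerProductSpace.rankOne ℂ (c k) (c k) with hσdef
  have hρ : 0 ≤ ρ := Finset.sum_nonneg fun i _ =>
    (ContinuousLinearMap.nonneg_iff_isPositive _).2 (InnerProductSpace.isPositive_rankOne_self _)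
  have hσ : 0 ≤ σ := Finset.sum_nonneg fun i _ =>
    (ContinuousLinearMap.nonneg_iff_isPositive _).2 (InnerProductSpace.isPositive_rankOne_self _)
  have h0 := mul_eq_zero_of_fidelity_eq_zero hρ hσ h
  have h1 : ∀ y, ⟪a i, σ y⟫_ℂ = 0 := fun y =>
    inner_eq_zero_of_sum_rankOne_apply_eq_zero (DFunLike.congr_fun h0 y) i
  have h2 : σ (a i) = 0 := by
    refine ext_inner_right ℂ fun y => ?_
    -- `ρ σ = 0` makes `a i` orthogonal to the range of `σ`, which is self-adjoint; hence `a i` lies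
    -- in its kernel.
    rw [inner_zero_left, ← ContinuousLinearMap.adjoint_inner_right,
      ← ContinuousLinearMap.star_eq_adjoint, hσ.isSelfAdjoint.star_eq]
    exact h1 y
  exact inner_eq_zero_symm.1 (inner_eq_zero_of_sum_rankOne_apply_eq_zero h2 k)

end Fidelity

/-! ### Components of a composite vector and the reduced state. -/

section PartialTrace

variable {S A : Type*} [NormedAddCommGroup S] [InnerProductSpace ℂ S]
  [NormedAddCommGroup A] [InnerProductSpace ℂ A]

theorem mapL_rankOne (q : S) (Ω : A) :
    TensorProduct.mapL (InnerProductSpace.rankOne ℂ q q) (InnerProductSpace.rankOne ℂ Ω Ω) =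
      InnerProductSpace.rankOne ℂ (q ⊗ₜ[ℂ] Ω) (q ⊗ₜ[ℂ] Ω) := by
  ext x
  induction x with
  | zero => simp
  | tmul s a =>
    rw [TensorProduct.mapL_tmul]
    simp only [InnerProductSpace.rankOne_apply, TensorProduct.smul_tmul_smul,
      TensorProduct.inner_tmul]
  | add x y hx hy => rw [map_add, map_add, hx, hy]

variable [FiniteDimensional ℂ S] [CompleteSpace A]

variable (A) in
/-- The partial inner product `⟨s| ⊗ 1`. -/
noncomputable abbrev partialInner (s : S) : (S ⊗[ℂ] A) →L[ℂ] A :=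
  (TensorProduct.mkL ℂ S A s).adjoint

theorem partialInner_tmul (s t : S) (a : A) : partialInner A s (t ⊗ₜ a) = ⟪s, t⟫_ℂ • a := by
  refine ext_inner_left ℂ fun y => ?_
  rw [ContinuousLinearMap.adjoint_inner_right, TensorProduct.mkL_apply_apply,
    TensorProduct.inner_tmul, inner_smul_right]

theorem sum_tmul_partialInner {ι : Type*} [Fintype ι] (b : OrthonormalBasis ι ℂ S)
    (x : S ⊗[ℂ] A) : ∑ i, b i ⊗ₜ[ℂ] partialInner A (b i) x = x := by
  induction x with
  | zero => simp
  | tmul s a =>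
    simp_rw [partialInner_tmul, ← TensorProduct.smul_tmul, ← TensorProduct.sum_tmul]
    rw [b.sum_repr']
  | add x y hx hy =>
    simp only [map_add, TensorProduct.tmul_add, Finset.sum_add_distrib, hx, hy]

theorem inner_tmul_right_eq_partialInner (x : S ⊗[ℂ] A) (s : S) (a : A) :
    ⟪x, s ⊗ₜ[ℂ] a⟫_ℂ = ⟪partialInner A s x, a⟫_ℂ := by
  rw [ContinuousLinearMap.adjoint_inner_left, TensorProduct.mkL_apply_apply]

theorem apparatusState_eq (W : (S ⊗[ℂ] A) →L[ℂ] (S ⊗[ℂ] A)) (q : S) (Ω : A) :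
    apparatusState W q Ω = ∑ i, InnerProductSpace.rankOne ℂ
      (partialInner A (stdOrthonormalBasis ℂ S i) (W (q ⊗ₜ Ω)))
      (partialInner A (stdOrthonormalBasis ℂ S i) (W (q ⊗ₜ Ω))) := by
  unfold apparatusState partialTrace
  refine Finset.sum_congr rfl fun i _ => ?_
  rw [mapL_rankOne]
  ext x
  simp only [ContinuousLinearMap.comp_apply, mul_apply_eq_comp,
    InnerProductSpace.rankOne_apply, map_smul, ContinuousLinearMap.star_eq_adjoint,
    ContinuousLinearMap.adjoint_inner_right, ContinuousLinearMap.adjoint_inner_left]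

/-- If the final apparatus states have zero fidelity, then the final states of the composite
system remain orthogonal after any operation on the system. -/
theorem inner_rTensor_eq_zero_of_fidelity_eq_zero (W : (S ⊗[ℂ] A) →L[ℂ] (S ⊗[ℂ] A))
    (q₀ q₁ : S) (Ω : A) (h : fidelity (apparatusState W q₀ Ω) (apparatusState W q₁ Ω) = 0)
    (B : S →L[ℂ] S) : ⟪W (q₀ ⊗ₜ Ω), B.rTensor A (W (q₁ ⊗ₜ Ω))⟫_ℂ = 0 := by
  rw [apparatusState_eq, apparatusState_eq] at h
  set b := stdOrthonormalBasis ℂ S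
  have horth := inner_eq_zero_of_fidelity_sum_rankOne h
  rw [← sum_tmul_partialInner b (W (q₁ ⊗ₜ Ω)), map_sum, inner_sum]
  refine Finset.sum_eq_zero fun k _ => ?_
  -- `B` mixes the basis vectors, so orthogonality is needed for every pair of components, not only
  -- for equal indices.
  rw [ContinuousLinearMap.rTensor_tmul, ← b.sum_repr' (B (b k)), TensorProduct.sum_tmul, inner_sum]
  refine Finset.sum_eq_zero fun i _ => ?_
  rw [TensorProduct.smul_tmul, inner_tmul_right_eq_partialInner, inner_smul_right,
    horth, mul_zero]

end PartialTrace

/-! ### Closure of the Hamiltonian and the Schrödinger equation. -/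

section Evolution

variable {E : Type*} [NormedAddCommGroup E] [InnerProductSpace ℂ E]

theorem mem_closure_graph_of_mem_graph_closure (H₀ : E →ₗ.[ℂ] E) {p : E × E}
    (hp : p ∈ H₀.closure.graph) : p ∈ closure (H₀.graph : Set (E × E)) := by
  by_cases hc : H₀.IsClosable
  · rw [← hc.graph_closure_eq_closure_graph] at hp
    exact hp
  -- By convention a non-closable operator is its own closure.
  · rw [LinearPMap.closure_def' hc] at hp
    exact subset_closure hp

variable [CompleteSpace E]

theorem inner_apply_eq_of_isSelfAdjoint {H : E →ₗ.[ℂ] E} (hH : IsSelfAdjoint H)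
    (x y : H.domain) : ⟪H x, y⟫_ℂ = ⟪(x : E), H y⟫_ℂ := by
  have h := LinearPMap.adjoint_isFormalAdjoint hH.dense_domain
  rw [LinearPMap.isSelfAdjoint_def.1 hH] at h
  exact h x y

/-- A bound on the commutator form of the closure `H` of `H₀` with `B`, from one on a core. -/
theorem norm_commutator_form_le {H₀ : E →ₗ.[ℂ] E} (hH : IsSelfAdjoint H₀.closure)
    {B : E →L[ℂ] E} {c : ℝ}
    (hc : ∀ ψ : H₀.domain, ∃ h : B ψ ∈ H₀.domain, ‖H₀ ⟨B ψ, h⟩ - B (H₀ ψ)‖ ≤ c * ‖(ψ : E)‖)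
    (φ ψ : H₀.closure.domain) :
    ‖⟪H₀.closure φ, B ψ⟫_ℂ - ⟪(φ : E), B (H₀.closure ψ)⟫_ℂ‖ ≤ c * (‖(φ : E)‖ * ‖(ψ : E)‖) := by
  have hle := H₀.le_closure
  -- As a condition on pairs in the graph the inequality is closed, so it passes to the closure
  -- without showing that `B` preserves the larger domain.
  have hclosed : IsClosed {r : (E × E) × (E × E) |
      ‖⟪r.1.2, B r.2.1⟫_ℂ - ⟪r.1.1, B r.2.2⟫_ℂ‖ ≤ c * (‖r.1.1‖ * ‖r.2.1‖)} :=
    isClosed_le (by fun_prop) (by fun_prop)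
  have hsub : (H₀.graph : Set (E × E)) ×ˢ (H₀.graph : Set (E × E)) ⊆ {r |
      ‖⟪r.1.2, B r.2.1⟫_ℂ - ⟪r.1.1, B r.2.2⟫_ℂ‖ ≤ c * (‖r.1.1‖ * ‖r.2.1‖)} := by
    rintro ⟨⟨x, x'⟩, ⟨y, y'⟩⟩ ⟨hx, hy⟩
    obtain ⟨u, rfl, rfl⟩ := (LinearPMap.mem_graph_iff _).1 hx
    obtain ⟨v, rfl, rfl⟩ := (LinearPMap.mem_graph_iff _).1 hy
    obtain ⟨hBv, hbound⟩ := hc v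
    have hext : ∀ w : H₀.domain, H₀.closure ⟨w, hle.1 w.2⟩ = H₀ w := fun w =>
      (hle.2 (x := w) (y := ⟨w, hle.1 w.2⟩) rfl).symm
    -- `H₀` inherits symmetry from its self-adjoint closure.
    have hsymm := inner_apply_eq_of_isSelfAdjoint hH ⟨u, hle.1 u.2⟩ ⟨B v, hle.1 hBv⟩
    rw [hext u, hext ⟨B v, hBv⟩] at hsymm
    change ‖⟪H₀ u, B v⟫_ℂ - ⟪(u : E), B (H₀ v)⟫_ℂ‖ ≤ c * (‖(u : E)‖ * ‖(v : E)‖)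
    rw [show ⟪H₀ u, B v⟫_ℂ = ⟪(u : E), H₀ ⟨B v, hBv⟩⟫_ℂ from hsymm, ← inner_sub_right]
    calc _ ≤ ‖(u : E)‖ * ‖H₀ ⟨B v, hBv⟩ - B (H₀ v)‖ := norm_inner_le_norm _ _
      _ ≤ ‖(u : E)‖ * (c * ‖(v : E)‖) := by gcongr
      _ = _ := by ring
  have hmem : (((φ : E), H₀.closure φ), ((ψ : E), H₀.closure ψ)) ∈
      closure ((H₀.graph : Set (E × E)) ×ˢ (H₀.graph : Set (E × E))) := by
    rw [closure_prod_eq]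
    exact ⟨mem_closure_graph_of_mem_graph_closure _ (LinearPMap.mem_graph _ φ),
      mem_closure_graph_of_mem_graph_closure _ (LinearPMap.mem_graph _ ψ)⟩
  exact closure_minimal hsub hclosed hmem

theorem IsTimeEvolution.norm_apply {ħ : ℝ} {H : E →ₗ.[ℂ] E} {U : ℝ → E →L[ℂ] E}
    (hU : IsTimeEvolution ħ H U) (t : ℝ) (ψ : E) : ‖U t ψ‖ = ‖ψ‖ :=
  ContinuousLinearMap.norm_map_of_mem_unitary (hU.mem_unitary t) ψ

/-- The Schrödinger equation. -/
theorem IsTimeEvolution.hasDerivAt {ħ : ℝ} {H : E →ₗ.[ℂ] E} {U : ℝ → E →L[ℂ] E}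
    (hU : IsTimeEvolution ħ H U) (ψ : H.domain) (t : ℝ) :
    ∃ h : U t ψ ∈ H.domain,
      HasDerivAt (fun s => U s ψ) ((-(Complex.I / (ħ : ℂ))) • H ⟨U t ψ, h⟩) t := by
  have h0 : HasDerivAt (fun s => U s ψ) ((-(Complex.I / (ħ : ℂ))) • H ψ) 0 :=
    (hU.generator ψ _).2 ⟨ψ.2, rfl⟩
  have h1 : HasDerivAt (fun s => U s (U t ψ)) (U t ((-(Complex.I / (ħ : ℂ))) • H ψ)) 0 := by
    have h2 := ((U t).restrictScalars ℝ).hasFDerivAt.comp_hasDerivAt (0 : ℝ) h0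
    refine h2.congr_of_eventuallyEq (Filter.Eventually.of_forall fun s => ?_)
    change (U s * U t) ψ = (U t * U s) ψ
    rw [← hU.map_add, ← hU.map_add, add_comm]
  -- The orbit of `U t ψ` is differentiable at `0`, and the domain of the generator consists exactly
  -- of such vectors.
  obtain ⟨h, heq⟩ := (hU.generator _ _).1 h1
  refine ⟨h, ?_⟩
  rw [heq, ← sub_self t] at h1
  have h3 := h1.comp_sub_const t t |>.congr_of_eventuallyEq (f₁ := fun s => U s ψ) ?_
  · exact h3
  · refine Filter.Eventually.of_forall fun s => ?_
    change U s ψ = (U (s - t) * U t) ψ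
    rw [← hU.map_add, sub_add_cancel]

/-- The change of a matrix element of `B` under the time evolution is bounded by the commutator
form of `H` and `B`. -/
theorem IsTimeEvolution.norm_inner_sub_inner_le {ħ : ℝ} (hħ : 0 < ħ) {H : E →ₗ.[ℂ] E}
    (hdense : Dense (H.domain : Set E)) {U : ℝ → E →L[ℂ] E}
    (hU : IsTimeEvolution ħ H U) {B : E →L[ℂ] E} {c : ℝ}
    (hc : ∀ φ ψ : H.domain,
      ‖⟪H φ, B ψ⟫_ℂ - ⟪(φ : E), B (H ψ)⟫_ℂ‖ ≤ c * (‖(φ : E)‖ * ‖(ψ : E)‖))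
    {τ : ℝ} (hτ : 0 ≤ τ) (φ ψ : E) :
    ħ * ‖⟪U τ φ, B (U τ ψ)⟫_ℂ - ⟪φ, B ψ⟫_ℂ‖ ≤ τ * (c * (‖φ‖ * ‖ψ‖)) := by
  -- The given vectors need not lie in `D(H)`. Both sides are continuous, so the dense domain
  -- suffices.
  have hclosed : IsClosed {r : E × E |
      ħ * ‖⟪U τ r.1, B (U τ r.2)⟫_ℂ - ⟪r.1, B r.2⟫_ℂ‖ ≤ τ * (c * (‖r.1‖ * ‖r.2‖))} :=
    isClosed_le (by fun_prop) (by fun_prop)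
  have hsub : (H.domain : Set E) ×ˢ (H.domain : Set E) ⊆ {r : E × E |
      ħ * ‖⟪U τ r.1, B (U τ r.2)⟫_ℂ - ⟪r.1, B r.2⟫_ℂ‖ ≤ τ * (c * (‖r.1‖ * ‖r.2‖))} := by
    rintro ⟨x, y⟩ ⟨hx, hy⟩
    change ħ * ‖⟪U τ x, B (U τ y)⟫_ℂ - ⟪x, B y⟫_ℂ‖ ≤ τ * (c * (‖x‖ * ‖y‖))
    choose hUx hdx using hU.hasDerivAt ⟨x, hx⟩
    choose hUy hdy using hU.hasDerivAt ⟨y, hy⟩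
    have hd : ∀ t, HasDerivAt (fun s => ⟪U s x, B (U s y)⟫_ℂ)
        ((Complex.I / (ħ : ℂ)) *
          (⟪H ⟨U t x, hUx t⟩, B (U t y)⟫_ℂ - ⟪U t x, B (H ⟨U t y, hUy t⟩)⟫_ℂ)) t := by
      intro t
      have hB := (B.restrictScalars ℝ).hasFDerivAt.comp_hasDerivAt t (hdy t)
      have h := (hdx t).inner ℂ hB
      refine h.congr_deriv ?_
      change ⟪U t x, B ((-(Complex.I / (ħ : ℂ))) • H ⟨U t y, hUy t⟩)⟫_ℂ +
        ⟪(-(Complex.I / (ħ : ℂ))) • H ⟨U t x, hUx t⟩, B (U t y)⟫_ℂ = _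
      rw [map_smul, inner_smul_right, inner_smul_left]
      simp only [map_neg, map_div₀, Complex.conj_I, Complex.conj_ofReal]
      ring
    have hmv := norm_image_sub_le_of_norm_deriv_le_segment' (a := 0) (b := τ)
      (fun t _ => (hd t).hasDerivWithinAt) (C := ħ⁻¹ * (c * (‖x‖ * ‖y‖))) (fun t _ => ?_) τ
      ⟨hτ, le_rfl⟩
    · simp only [hU.map_zero, one_apply_eq_self, sub_zero] at hmv
      calc _ ≤ ħ * (ħ⁻¹ * (c * (‖x‖ * ‖y‖)) * τ) := by gcongr
        _ = _ := by field_simp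
    · rw [norm_mul, norm_div, Complex.norm_I, Complex.norm_real, Real.norm_of_nonneg hħ.le, one_div]
      have := hc ⟨U t x, hUx t⟩ ⟨U t y, hUy t⟩
      -- Unitarity makes the bound on the derivative independent of time.
      simp only [hU.norm_apply] at this
      gcongr
  have hmem : (φ, ψ) ∈ closure ((H.domain : Set E) ×ˢ (H.domain : Set E)) := by
    rw [closure_prod_eq]
    exact ⟨hdense φ, hdense ψ⟩
  exact closure_minimal hsub hclosed hmem

end Evolution

/-! ### Pointwise bounds from the commutator norm. -/

section Commutator

variable {E : Type*} [NormedAddCommGroup E] [InnerProductSpace ℂ E]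

theorem exists_norm_commutator_le {V : E →ₗ.[ℂ] E} {B : E →L[ℂ] E}
    (h : commutatorNorm V B ≠ ∞) (ψ : V.domain) :
    ∃ hψ : B ψ ∈ V.domain,
      ‖V ⟨B ψ, hψ⟩ - B (V ψ)‖ ≤ (commutatorNorm V B).toReal * ‖(ψ : E)‖ := by
  classical
  have hle : (if h : B ψ ∈ V.domain then
      ‖V ⟨B ψ, h⟩ - B (V ψ)‖ₑ / ‖(ψ : E)‖ₑ else ∞) ≤ commutatorNorm V B := by
    unfold commutatorNorm
    exact le_iSup_of_le ψ (by split_ifs <;> rfl)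
  by_cases hψ : B ψ ∈ V.domain
  · refine ⟨hψ, ?_⟩
    rw [dif_pos hψ] at hle
    rcases eq_or_ne ψ 0 with rfl | h0
    · have hz : (⟨B (0 : V.domain), hψ⟩ : V.domain) = 0 := Subtype.ext (by simp)
      rw [hz]
      simp
    · have hn : ‖(ψ : E)‖ₑ ≠ 0 := by simpa using h0
      rw [ENNReal.div_le_iff hn (by simp)] at hle
      have := ENNReal.toReal_mono (ENNReal.mul_ne_top h (by simp)) hle
      simpa using this
  · rw [dif_neg hψ] at hle
    exact absurd (top_le_iff.1 hle) h

theorem CommutesWith.commutatorNorm_eq_zero {V : E →ₗ.[ℂ] E} {B : E →L[ℂ] E}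
    (h : CommutesWith V B) : commutatorNorm V B = 0 := by
  unfold commutatorNorm
  refine ENNReal.iSup_eq_zero.2 fun ψ => ?_
  obtain ⟨hψ, heq⟩ := h ψ
  rw [dif_pos hψ, heq]
  simp

end Commutator

/-! ### Only the interaction contributes to the commutator. -/

section Hamiltonian

variable {S A : Type*} [NormedAddCommGroup S] [InnerProductSpace ℂ S]
  [NormedAddCommGroup A] [InnerProductSpace ℂ A]

/-- The operators act on different tensor factors, and `B ⊗ 1` preserves `S ⊗ D(T)`. -/
theorem commutesWith_oneTensor (T : A →ₗ.[ℂ] A) (B : S →L[ℂ] S) :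
    CommutesWith (oneTensor S T) (B.rTensor A) := by
  rintro ⟨_, x, rfl⟩
  have hx : B.rTensor A (T.domain.subtype.lTensor S x) =
      T.domain.subtype.lTensor S (B.toLinearMap.rTensor T.domain x) := by
    rw [ContinuousLinearMap.rTensor_apply, ← LinearMap.comp_apply, ← LinearMap.comp_apply,
      LinearMap.rTensor_comp_lTensor, LinearMap.lTensor_comp_rTensor]
  have hmem : B.rTensor A (T.domain.subtype.lTensor S x) ∈ (oneTensor S T).domain :=
    ⟨_, hx.symm⟩
  refine ⟨hmem, ?_⟩
  have hsub : (⟨_, hmem⟩ : (oneTensor S T).domain) =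
      ⟨T.domain.subtype.lTensor S (B.toLinearMap.rTensor T.domain x), hx ▸ hmem⟩ :=
    Subtype.ext hx
  refine (congrArg (oneTensor S T) hsub).trans ?_
  rw [oneTensor_apply]
  refine Eq.trans ?_ (congrArg (B.rTensor A) (oneTensor_apply T x ⟨x, rfl⟩)).symm
  rw [ContinuousLinearMap.rTensor_apply,
    ← LinearMap.comp_apply, ← LinearMap.comp_apply, LinearMap.rTensor_comp_lTensor,
    LinearMap.lTensor_comp_rTensor]

theorem exists_norm_commutator_sum_le (HS : S →L[ℂ] S) (HA : A →ₗ.[ℂ] A)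
    {V : (S ⊗[ℂ] A) →ₗ.[ℂ] (S ⊗[ℂ] A)} (h : commutatorNorm V (HS.rTensor A) ≠ ∞)
    (ψ : (ofBounded (HS.rTensor A) + oneTensor S HA + V).domain) :
    ∃ hψ : HS.rTensor A ψ ∈ (ofBounded (HS.rTensor A) + oneTensor S HA + V).domain,
      ‖(ofBounded (HS.rTensor A) + oneTensor S HA + V) ⟨HS.rTensor A ψ, hψ⟩ -
        HS.rTensor A ((ofBounded (HS.rTensor A) + oneTensor S HA + V) ψ)‖ ≤
      (commutatorNorm V (HS.rTensor A)).toReal * ‖(ψ : S ⊗[ℂ] A)‖ := by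
  obtain ⟨ψ, ⟨-, hA⟩, hV⟩ := ψ
  obtain ⟨hA', eA⟩ := commutesWith_oneTensor HA HS ⟨ψ, hA⟩
  obtain ⟨hV', eV⟩ := exists_norm_commutator_le h ⟨ψ, hV⟩
  refine ⟨⟨⟨trivial, hA'⟩, hV'⟩, ?_⟩
  refine (congrArg norm ?_).trans_le eV
  change (HS.rTensor A (HS.rTensor A ψ) + oneTensor S HA ⟨HS.rTensor A ψ, hA'⟩ +
      V ⟨HS.rTensor A ψ, hV'⟩) - HS.rTensor A (HS.rTensor A ψ + oneTensor S HA ⟨ψ, hA⟩ +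
      V ⟨ψ, hV⟩) = _
  rw [eA, map_add, map_add]
  abel

end Hamiltonian

/-! ### The commutator with a projection in dimension two. -/

section Qubit

variable {S : Type*} [NormedAddCommGroup S] [InnerProductSpace ℂ S] [CompleteSpace S]

/-- In a two-dimensional space the commutator of a projection with a self-adjoint operator is
off-diagonal, and its norm is that of the off-diagonal matrix element. -/
theorem norm_projection_commutator_le (hdim : Module.finrank ℂ S = 2) {Q H : S →L[ℂ] S}
    (hQ : IsSelfAdjoint Q) (hH : IsSelfAdjoint H) {q₀ q₁ : S} (hq₀ : ‖q₀‖ = 1)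
    (hq₁ : ‖q₁‖ = 1) (hQ₀ : Q q₀ = 0) (hQ₁ : Q q₁ = q₁) :
    ‖Q * H - H * Q‖ ≤ ‖⟪q₀, H q₁⟫_ℂ‖ := by
  have hQs := ContinuousLinearMap.isSelfAdjoint_iff_isSymmetric.1 hQ
  have hHs := ContinuousLinearMap.isSelfAdjoint_iff_isSymmetric.1 hH
  have h01 : ⟪q₀, q₁⟫_ℂ = 0 := by
    have := hQs q₀ q₁
    change ⟪Q q₀, q₁⟫_ℂ = ⟪q₀, Q q₁⟫_ℂ at this
    rw [hQ₀, hQ₁, inner_zero_left] at this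
    exact this.symm
  have hon : Orthonormal ℂ ![q₀, q₁] := by
    rw [orthonormal_vecCons_iff]
    refine ⟨hq₀, fun i => by fin_cases i; exact h01, ?_⟩
    rw [orthonormal_vecCons_iff]
    exact ⟨hq₁, fun i => i.elim0, ⟨fun i => i.elim0, fun i => i.elim0⟩⟩
  have : FiniteDimensional ℂ S := Module.finite_of_finrank_eq_succ hdim
  let b : OrthonormalBasis (Fin 2) ℂ S := OrthonormalBasis.mk hon
    (hon.linearIndependent.span_eq_top_of_card_eq_finrank' (by simp [hdim])).ge
  have hb0 : b 0 = q₀ := by simp [b]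
  have hb1 : b 1 = q₁ := by simp [b]
  have hexp : ∀ x, ⟪q₀, x⟫_ℂ • q₀ + ⟪q₁, x⟫_ℂ • q₁ = x := by
    intro x
    have := b.sum_repr' x
    rwa [Fin.sum_univ_two, hb0, hb1] at this
  have hnorm : ∀ x, ‖⟪q₀, x⟫_ℂ‖ ^ 2 + ‖⟪q₁, x⟫_ℂ‖ ^ 2 = ‖x‖ ^ 2 := by
    intro x
    have := b.sum_sq_norm_inner_right x
    rwa [Fin.sum_univ_two, hb0, hb1] at this
  -- In dimension two, `q₀` and `q₁` form an orthonormal basis, which determines `Q`.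
  have hQx : ∀ x, Q x = ⟪q₁, x⟫_ℂ • q₁ := by
    intro x
    conv_lhs => rw [← hexp x]
    rw [map_add, map_smul, map_smul, hQ₀, hQ₁, smul_zero, zero_add]
  have h10 : ‖⟪q₁, H q₀⟫_ℂ‖ = ‖⟪q₀, H q₁⟫_ℂ‖ := by
    rw [norm_inner_symm]
    exact congrArg norm (hHs q₀ q₁)
  refine ContinuousLinearMap.opNorm_le_bound _ (norm_nonneg _) fun x => ?_
  have hC : (Q * H - H * Q) x = -(⟪q₁, x⟫_ℂ * ⟪q₀, H q₁⟫_ℂ) • q₀ +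
      (⟪q₀, x⟫_ℂ * ⟪q₁, H q₀⟫_ℂ) • q₁ := by
    change Q (H x) - H (Q x) = _
    rw [hQx, hQx, map_smul]
    have e1 : ⟪q₁, H x⟫_ℂ = ⟪q₀, x⟫_ℂ * ⟪q₁, H q₀⟫_ℂ + ⟪q₁, x⟫_ℂ * ⟪q₁, H q₁⟫_ℂ := by
      conv_lhs => rw [← hexp x]
      rw [map_add, map_smul, map_smul, inner_add_right, inner_smul_right, inner_smul_right]
    rw [e1]
    have e2 : ⟪q₁, x⟫_ℂ • H q₁ = (⟪q₁, x⟫_ℂ * ⟪q₀, H q₁⟫_ℂ) • q₀ +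
        (⟪q₁, x⟫_ℂ * ⟪q₁, H q₁⟫_ℂ) • q₁ := by
      conv_lhs => rw [← hexp (H q₁)]
      module
    rw [e2]
    module
  have h11 : ⟪q₁, q₁⟫_ℂ = 1 := by simp [inner_self_eq_norm_sq_to_K, hq₁]
  have h00 : ⟪q₀, q₀⟫_ℂ = 1 := by simp [inner_self_eq_norm_sq_to_K, hq₀]
  have h10' : ⟪q₁, q₀⟫_ℂ = 0 := inner_eq_zero_symm.1 h01
  refine le_of_sq_le_sq ?_ (by positivity)
  rw [← hnorm, hC]
  simp only [inner_add_right, inner_smul_right, h11, h00, h10', h01, mul_zero, mul_one, add_zero,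
    zero_add, norm_neg, norm_mul, h10]
  rw [mul_pow, mul_pow, mul_pow, ← hnorm x]
  -- The two off-diagonal entries have equal modulus, so the commutator is a multiple of an
  -- isometry.
  apply le_of_eq
  ring

end Qubit

end QMeas

theorem corollary2 {S A : Type*}
    [NormedAddCommGroup S] [InnerProductSpace ℂ S] [CompleteSpace S] [FiniteDimensional ℂ S]
    [NormedAddCommGroup A] [InnerProductSpace ℂ A] [CompleteSpace A]
    (hdim : Module.finrank ℂ S = 2)
    (Q HS : S →L[ℂ] S) (hQ : IsStarProjection Q) (hHS : IsSelfAdjoint HS)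
    (q₀ q₁ : S) (hq₀ : ‖q₀‖ = 1) (hq₁ : ‖q₁‖ = 1) (hQ₀ : Q q₀ = 0) (hQ₁ : Q q₁ = q₁)
    (HA : A →ₗ.[ℂ] A) (hHA : IsSelfAdjoint HA)
    (V : (S ⊗[ℂ] A) →ₗ.[ℂ] (S ⊗[ℂ] A)) (hV : IsSelfAdjoint V)
    (hH : IsSelfAdjoint (QMeas.totalHamiltonian HS HA V))
    (ħ : ℝ) (hħ : 0 < ħ) (U : ℝ → (S ⊗[ℂ] A) →L[ℂ] (S ⊗[ℂ] A))
    (hU : QMeas.IsTimeEvolution ħ (QMeas.totalHamiltonian HS HA V) U)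
    (Ω : A) (hΩ : ‖Ω‖ = 1) (τ : ℝ) (hτ : 0 ≤ τ)
    (herrorfree : QMeas.fidelity (QMeas.apparatusState (U τ) q₀ Ω)
      (QMeas.apparatusState (U τ) q₁ Ω) = 0) :
    ENNReal.ofReal τ * QMeas.commutatorNorm V (HS.rTensor A) ≥
        ENNReal.ofReal (ħ * ‖Q * HS - HS * Q‖) ∧
      (¬ Commute Q HS → ¬ QMeas.CommutesWith V (HS.rTensor A)) := by
  have hzero := QMeas.inner_rTensor_eq_zero_of_fidelity_eq_zero (U τ) q₀ q₁ Ω herrorfree HS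
  have hinit : ⟪q₀ ⊗ₜ[ℂ] Ω, HS.rTensor A (q₁ ⊗ₜ[ℂ] Ω)⟫_ℂ = ⟪q₀, HS q₁⟫_ℂ := by
    rw [ContinuousLinearMap.rTensor_tmul, TensorProduct.inner_tmul,
      inner_self_eq_norm_sq_to_K, hΩ]
    simp
  have hC := QMeas.norm_projection_commutator_le hdim hQ.isSelfAdjoint hHS hq₀ hq₁ hQ₀ hQ₁
  have hmain : ENNReal.ofReal (ħ * ‖Q * HS - HS * Q‖) ≤
      ENNReal.ofReal τ * QMeas.commutatorNorm V (HS.rTensor A) := by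
    -- At `τ = 0` the commutator norm may be `∞` and `0 * ∞ = 0`. The initial and final matrix
    -- elements then coincide, so `[Q, HS] = 0`.
    rcases hτ.eq_or_lt with rfl | hpos
    · rw [hU.map_zero, one_apply_eq_self, one_apply_eq_self, hinit] at hzero
      rw [hzero, norm_zero] at hC
      rw [le_antisymm hC (norm_nonneg _)]
      simp
    by_cases htop : QMeas.commutatorNorm V (HS.rTensor A) = ∞
    · rw [htop, ENNReal.mul_top (by simpa using hpos)]
      exact le_top
    have hform := QMeas.norm_commutator_form_le hH
      (QMeas.exists_norm_commutator_sum_le HS HA htop)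
    have hevol := hU.norm_inner_sub_inner_le hħ hH.dense_domain hform hτ
      (q₀ ⊗ₜ[ℂ] Ω) (q₁ ⊗ₜ[ℂ] Ω)
    rw [hzero, hinit, zero_sub, norm_neg, TensorProduct.norm_tmul, TensorProduct.norm_tmul,
      hq₀, hq₁, hΩ, mul_one, mul_one, mul_one] at hevol
    rw [← ENNReal.ofReal_toReal htop, ← ENNReal.ofReal_mul hτ]
    exact ENNReal.ofReal_le_ofReal ((mul_le_mul_of_nonneg_left hC hħ.le).trans hevol)
  refine ⟨hmain, fun hne hcomm => hne ?_⟩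
  rw [hcomm.commutatorNorm_eq_zero, mul_zero, nonpos_iff_eq_zero, ENNReal.ofReal_eq_zero] at hmain
  have hnorm : ‖Q * HS - HS * Q‖ ≤ 0 := nonpos_of_mul_nonpos_right hmain hħ
  exact sub_eq_zero.1 (norm_le_zero_iff.1 hnorm)
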